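/- \textbf{Lemma (RIP of the compressed sensing matrix on a union of subspaces).} There is an absolute constant $C>0$ such that the following holds. Let $\mathbb{K}$ be $\mathbb{R}$ or $\mathbb{C}$, let $n,m,M,\ell\ge 1$ be integers, let $\mathcal{T}=\mathcal{U}_1\cup\dots\cup\mathcal{U}_M\subseteq\mathbb{K}^n$ be a union of $M$ linear subspaces, each of dimension at most $\ell$, and let $F\in\mathbb{K}^{n\times n}$ be a unitary matrix. Let $\boldsymbol{\alpha}$ be the vector of local coherences of $F$ with respect to $\mathcal{T}$, that is, $$\alpha_j=\sup\{|\boldsymbol{f}_j^*\boldsymbol{x}| : \boldsymbol{x}\in\mathcal{T},\ \|\boldsymbol{x}\|_2\le 1\},\qquad j=1,\dots,n,$$ where $\boldsymbol{f}_j$ is the conjugate transpose of the $j$-th row of $F$. Let $\boldsymbol{w}\in(0,1]^n$ satisfy $\sum_{i=1}^n w_i=m$, and put $$\gamma(\boldsymbol{\alpha},\boldsymbol{w})=\max_{1\le j\le n}\ \alpha_j\sqrt{m}\,\max\!\left(\sqrt{\tfrac{1-w_j}{w_j}},\,1\right)\mathbf{1}_{\{w_j<1\}} .$$ Let $S$ be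 the Bernoulli sampling matrix with probability weights $\boldsymbol{w}$: the matrix obtained from the $n\times n$ diagonal matrix with diagonal entries $\sqrt{n/m}\,\xi_i$, where $\xi_1,\dots,\xi_n$ are independent and $\xi_i\sim\mathrm{Ber}(w_i)$, by removing the rows that are $0$. Let $D=\mathrm{Diag}(\boldsymbol{d})$ with $d_i=\sqrt{m/(n w_i)}$. If $t>0$ and $$m\ \ge\ C\,\gamma^2(\boldsymbol{\alpha},\boldsymbol{w})\left(\log\ell+\log M+t^2\right),$$ then, with probability at least $1-2\exp(-t^2)$, the matrix $SDF$ has the restricted isometry property on $\mathcal{T}$: $$\bigl|\,\|SDF\boldsymbol{u}\|_2-1\,\bigr|\le\tfrac13\qquad\text{for all }\boldsymbol{u}\in\mathcal{T}\text{ with }\|\boldsymbol{u}\|_2=1 .$$ -/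

import Mathlib

open MeasureTheory ProbabilityTheory
open scoped Matrix

noncomputable section

namespace BernoulliCS

variable {𝕜 : Type*} [RCLike 𝕜] {n : ℕ}

/-- The local coherence of a vector `φ` with respect to a set `T` (a cone, in the applications):
the supremum of `|φ* x|` over the points `x` of `T` in the closed Euclidean unit ball. The set of
values is bounded by `‖φ‖`. -/
def localCoherence (T : Set (EuclideanSpace 𝕜 (Fin n))) (φ : EuclideanSpace 𝕜 (Fin n)) : ℝ :=
  sSup ((fun x => ‖inner 𝕜 φ x‖) '' (T ∩ Metric.closedBall 0 1))

/-- The conjugate transpose of the `j`-th row of `F`, as a vector. -/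
def rowVec (F : Matrix (Fin n) (Fin n) 𝕜) (j : Fin n) : EuclideanSpace 𝕜 (Fin n) :=
  WithLp.toLp 2 (fun k => star (F j k))

/-- The vector of local coherences of a matrix `F` with respect to `T`. -/
def localCoherences (F : Matrix (Fin n) (Fin n) 𝕜) (T : Set (EuclideanSpace 𝕜 (Fin n))) :
    Fin n → ℝ :=
  fun j => localCoherence T (rowVec F j)

/-- The tight Bernoulli complexity: the maximum over `j` of
`α_j √m max(√((1 - w_j) / w_j), 1) 1_{w_j < 1}`. -/
def bernoulliComplexity (m : ℕ) (α w : Fin n → ℝ) : ℝ :=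
  ⨆ j : Fin n, α j * √(m : ℝ) * max √((1 - w j) / w j) 1 * (if w j < 1 then 1 else 0)

variable (𝕜) in
/-- The square diagonal matrix with diagonal entries `√(n / m) ξ_i`. -/
def selectorMatrix (m : ℕ) (ξ : Fin n → ℝ) : Matrix (Fin n) (Fin n) 𝕜 :=
  Matrix.diagonal (fun i => ((√((n : ℝ) / (m : ℝ)) * ξ i : ℝ) : 𝕜))

instance (m : ℕ) (ξ : Fin n → ℝ) : Fintype {i : Fin n // selectorMatrix 𝕜 m ξ i ≠ 0} :=
  Fintype.ofFinite _

variable (𝕜) in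
/-- The sampling matrix: the square diagonal matrix with its zero rows removed. -/
def samplingMatrix (m : ℕ) (ξ : Fin n → ℝ) :
    Matrix {i : Fin n // selectorMatrix 𝕜 m ξ i ≠ 0} (Fin n) 𝕜 :=
  (selectorMatrix 𝕜 m ξ).submatrix Subtype.val id

variable (𝕜) in
/-- The diagonal preconditioner with entries `d_i = √(m / (n w_i))`. -/
def preconditioner (m : ℕ) (w : Fin n → ℝ) : Matrix (Fin n) (Fin n) 𝕜 :=
  Matrix.diagonal (fun i => ((√((m : ℝ) / ((n : ℝ) * w i)) : ℝ) : 𝕜))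

/-- The restricted isometry property on `T`: the supremum of `|‖A u‖₂ - 1|` over the unit vectors
`u` of `T` is at most `1 / 3`. -/
def RIP {ι : Type*} [Fintype ι] (A : Matrix ι (Fin n) 𝕜)
    (T : Set (EuclideanSpace 𝕜 (Fin n))) : Prop :=
  ∀ u ∈ T ∩ Metric.sphere 0 1,
    |‖(WithLp.toLp 2 (A *ᵥ u.ofLp) : EuclideanSpace 𝕜 ι)‖ - 1| ≤ 1 / 3

end BernoulliCS

end

/-!
# Restricted isometry of Bernoulli-sampled unitary matrices on a union of subspaces

Fix one of the subspaces and write the unitary matrix `F` in an orthonormal basis of it, as a tall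
matrix `V` with rows `v_i*` and `V* V = 1` (`exists_coordinates`). For the outcome `b` of the
Bernoulli variables, `‖S D F u‖² - ‖u‖²` is the quadratic form of the Hermitian matrix
`X = ∑ i, (b i / w i - 1) • v_i v_i*`, so it suffices that the eigenvalues of `X` are at most
`1 / 2` in absolute value. The definition of the coherences gives `‖v_i‖² ≤ α_i²` (`sum_norm_sq_row_le`),
hence `‖v_i‖² max((1 - w_i) / w_i, 1) ≤ K = γ² / m` whenever `w_i < 1`
(`sq_mul_max_le_bernoulliComplexity`).

The eigenvalues are controlled through the moments `E tr X ^ (2 p)`, by the method of exchangeable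
pairs. Since `E (b i / w i - 1) = 0`, resampling coordinate `i` expresses the contribution of `i` to
`E tr X ^ (2 p + 2)` through a difference `tr (v_i v_i* (X ^ (2 p + 1) - Y ^ (2 p + 1)))`, where `X`
and `Y` differ by a multiple of `v_i v_i*`. The mean value trace inequality
`re_trace_sub_mul_pow_sub_pow_le` bounds it by even powers: the spectral theorem turns mixed trace
moments of two Hermitian matrices into those of a nonnegative measure on pairs of eigenvalues
(`exists_trace_pow_mul_pow`), which leaves a scalar inequality. The resulting variance proxy is at
most `K (X + 3)`, because `b i / w i - 1` is bounded below, and so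
`E tr X ^ (2 p + 2) ≤ (2 p + 1) / 2 * K * E tr ((X + 3) X ^ (2 p))` (`traceMoment_even_le`).
Absorbing the odd moment and iterating yields `E tr X ^ (2 p) ≤ (8 p K) ^ p ℓ` as long as
`2 p K ≤ 1` (`traceMoment_even_le_pow`).

Markov's inequality with `p` of order `log ℓ + log M + t²` bounds the failure probability on one
subspace by `exp (-t²) / M`, and a union bound over the `M` subspaces finishes the argument. The
factor `2` in front of `exp (-t²)` only serves to make the case `t² ≤ log 2` trivial.
-/

namespace BernoulliCS

/-! ### Trace inequalities for Hermitian matrices -/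

section Trace

variable {𝕜 : Type*} [RCLike 𝕜] {κ : Type*} [Fintype κ]

lemma star_dotProduct_self_eq_sum_norm_sq (v : κ → 𝕜) :
    star v ⬝ᵥ v = ((∑ a, ‖v a‖ ^ 2 : ℝ) : 𝕜) := by
  simp only [dotProduct, Pi.star_apply, RCLike.star_def, RCLike.conj_mul]
  push_cast
  rfl

variable [DecidableEq κ]

lemma exists_pow_eq_mul_diagonal_mul {X : Matrix κ κ 𝕜} (hX : X.IsHermitian) :
    ∃ (U : Matrix κ κ 𝕜) (x : κ → ℝ), Uᴴ * U = 1 ∧ U * Uᴴ = 1 ∧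
      ∀ k : ℕ, X ^ k = U * Matrix.diagonal (fun a => ((x a ^ k : ℝ) : 𝕜)) * Uᴴ := by
  obtain ⟨U, x, h1, h2, hs⟩ : ∃ (U : Matrix κ κ 𝕜) (x : κ → ℝ), Uᴴ * U = 1 ∧ U * Uᴴ = 1 ∧
      X = U * Matrix.diagonal (fun a => (x a : 𝕜)) * Uᴴ := by
    refine ⟨hX.eigenvectorUnitary, hX.eigenvalues,
      Unitary.coe_star_mul_self hX.eigenvectorUnitary,
      Unitary.coe_mul_star_self hX.eigenvectorUnitary, ?_⟩
    conv_lhs => rw [hX.spectral_theorem, Unitary.conjStarAlgAut_apply]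
    rfl
  refine ⟨U, x, h1, h2, fun k => ?_⟩
  induction k with
  | zero => simp [h2]
  | succ k ih =>
    calc X ^ (k + 1) = U * Matrix.diagonal (fun a => ((x a ^ k : ℝ) : 𝕜)) * (Uᴴ * U) *
          Matrix.diagonal (fun a => (x a : 𝕜)) * Uᴴ := by
          rw [pow_succ, ih, hs]
          simp only [Matrix.mul_assoc]
      _ = _ := by
          rw [h1, Matrix.mul_one, Matrix.mul_assoc _ (Matrix.diagonal _) (Matrix.diagonal _),
            Matrix.diagonal_mul_diagonal]
          simp [pow_succ]

/-- Two Hermitian matrices behave under the trace like two commuting real variables: the mixed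
moments `tr (X ^ j * Y ^ k)` are those of a nonnegative measure on pairs of eigenvalues, with
weight `|⟨e_a, g_b⟩|²` at the pair of eigenvectors `e_a` of `X` and `g_b` of `Y`. Trace
inequalities for two matrices thus reduce to scalar ones. -/
lemma exists_trace_pow_mul_pow {X Y : Matrix κ κ 𝕜} (hX : X.IsHermitian) (hY : Y.IsHermitian) :
    ∃ (x y : κ → ℝ) (c : κ → κ → ℝ), (∀ a b, 0 ≤ c a b) ∧
      ∀ j k : ℕ, RCLike.re (X ^ j * Y ^ k).trace = ∑ a, ∑ b, c a b * (x a ^ j * y b ^ k) := by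
  obtain ⟨U, x, hU, hU', hx⟩ := exists_pow_eq_mul_diagonal_mul hX
  obtain ⟨W, y, hW, hW', hy⟩ := exists_pow_eq_mul_diagonal_mul hY
  refine ⟨x, y, fun a b => ‖(Uᴴ * W) a b‖ ^ 2, fun _ _ => by positivity, fun j k => ?_⟩
  have h : (X ^ j * Y ^ k).trace = (Matrix.diagonal (fun a => ((x a ^ j : ℝ) : 𝕜)) * (Uᴴ * W) *
      (Matrix.diagonal (fun a => ((y a ^ k : ℝ) : 𝕜)) * (Uᴴ * W)ᴴ)).trace := by
    rw [hx, hy, Matrix.conjTranspose_mul, Matrix.conjTranspose_conjTranspose, Matrix.mul_assoc U,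
      Matrix.mul_assoc U, Matrix.trace_mul_comm U]
    simp only [Matrix.mul_assoc]
  rw [h, Matrix.trace, map_sum]
  refine Finset.sum_congr rfl fun a _ => ?_
  rw [Matrix.diag_apply, Matrix.mul_apply, map_sum]
  refine Finset.sum_congr rfl fun b _ => ?_
  rw [Matrix.diagonal_mul, Matrix.diagonal_mul, Matrix.conjTranspose_apply]
  have : ((x a ^ j : ℝ) : 𝕜) * (Uᴴ * W) a b * (((y b ^ k : ℝ) : 𝕜) * star ((Uᴴ * W) a b))
      = ((‖(Uᴴ * W) a b‖ ^ 2 * (x a ^ j * y b ^ k) : ℝ) : 𝕜) := by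
    have := RCLike.mul_conj ((Uᴴ * W) a b)
    rw [starRingEnd_apply] at this
    push_cast
    linear_combination (x a : 𝕜) ^ j * (y b : 𝕜) ^ k * this
  rw [this, RCLike.ofReal_re]

/-- The difference quotient of `x ^ (r + 1)`, for even `r`, is a sum of `r + 1` monomials
`x ^ j * y ^ (r - j)`; those for `j` and `r - j` together are at most `x ^ r + y ^ r`. -/
lemma sub_mul_pow_sub_pow_le (x y : ℝ) (p : ℕ) :
    (x - y) * (x ^ (2 * p + 1) - y ^ (2 * p + 1)) ≤
      (2 * p + 1) / 2 * ((x - y) ^ 2 * (x ^ (2 * p) + y ^ (2 * p))) := by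
  have key : ∀ j ∈ Finset.range (2 * p + 1),
      x ^ j * y ^ (2 * p + 1 - 1 - j) +
        x ^ (2 * p + 1 - 1 - j) * y ^ (2 * p + 1 - 1 - (2 * p + 1 - 1 - j)) ≤
      x ^ (2 * p) + y ^ (2 * p) := by
    intro j hj
    obtain ⟨k, hk⟩ : ∃ k, 2 * p = j + k := ⟨2 * p - j, by grind⟩
    have e1 : 2 * p + 1 - 1 - j = k := by omega
    have e2 : 2 * p + 1 - 1 - k = j := by omega
    rw [e1, e2]
    have hx : x ^ (2 * p) = |x| ^ j * |x| ^ k := by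
      rw [← pow_add, ← hk, pow_mul |x|, sq_abs, ← pow_mul]
    have hy : y ^ (2 * p) = |y| ^ j * |y| ^ k := by
      rw [← pow_add, ← hk, pow_mul |y|, sq_abs, ← pow_mul]
    have h1 : x ^ j * y ^ k ≤ |x| ^ j * |y| ^ k := by
      rw [← abs_pow, ← abs_pow, ← abs_mul]; exact le_abs_self _
    have h2 : x ^ k * y ^ j ≤ |x| ^ k * |y| ^ j := by
      rw [← abs_pow, ← abs_pow, ← abs_mul]; exact le_abs_self _
    have h3 : 0 ≤ (|x| ^ j - |y| ^ j) * (|x| ^ k - |y| ^ k) := by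
      rcases le_total |x| |y| with h | h
      · exact mul_nonneg_of_nonpos_of_nonpos
          (sub_nonpos.2 (pow_le_pow_left₀ (abs_nonneg _) h _))
          (sub_nonpos.2 (pow_le_pow_left₀ (abs_nonneg _) h _))
      · exact mul_nonneg (sub_nonneg.2 (pow_le_pow_left₀ (abs_nonneg _) h _))
          (sub_nonneg.2 (pow_le_pow_left₀ (abs_nonneg _) h _))
    rw [hx, hy]
    linarith
  have hs := Finset.sum_le_sum key
  rw [Finset.sum_add_distrib, Finset.sum_range_reflect
    (fun j => x ^ j * y ^ (2 * p + 1 - 1 - j)) (2 * p + 1), Finset.sum_const, Finset.card_range,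
    nsmul_eq_mul] at hs
  have hg := (Commute.all x y).geom_sum₂_mul (2 * p + 1)
  rw [← hg]
  simp only [Nat.add_sub_cancel] at hs ⊢
  push_cast at hs
  nlinarith [mul_le_mul_of_nonneg_left hs (sq_nonneg (x - y))]

/-- The mean value trace inequality for the odd power `t ↦ t ^ (2 * p + 1)`. -/
lemma re_trace_sub_mul_pow_sub_pow_le {X Y : Matrix κ κ 𝕜} (hX : X.IsHermitian)
    (hY : Y.IsHermitian) (p : ℕ) :
    RCLike.re ((X - Y) * (X ^ (2 * p + 1) - Y ^ (2 * p + 1))).trace ≤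
      (2 * p + 1) / 2 *
        RCLike.re ((X - Y) * (X - Y) * (X ^ (2 * p) + Y ^ (2 * p))).trace := by
  obtain ⟨x, y, c, hc, h⟩ := exists_trace_pow_mul_pow hX hY
  -- Cyclicity of the trace sorts every word in `X` and `Y` that occurs into `X ^ j * Y ^ k`.
  have e1 : ((X - Y) * (X ^ (2 * p + 1) - Y ^ (2 * p + 1))).trace =
      (X ^ (2 * p + 2) * Y ^ 0).trace - (X ^ 1 * Y ^ (2 * p + 1)).trace
        - (X ^ (2 * p + 1) * Y ^ 1).trace + (X ^ 0 * Y ^ (2 * p + 2)).trace := by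
    have : (Y * X ^ (2 * p + 1)).trace = (X ^ (2 * p + 1) * Y ^ 1).trace := by
      rw [Matrix.trace_mul_comm, pow_one]
    rw [← this, sub_mul, mul_sub, mul_sub]
    simp only [Matrix.trace_sub, pow_zero, mul_one, one_mul, pow_one, pow_succ' _ (2 * p + 1)]
    ring
  have e2 : ((X - Y) * (X - Y) * (X ^ (2 * p) + Y ^ (2 * p))).trace =
      (X ^ (2 * p + 2) * Y ^ 0).trace - 2 * (X ^ (2 * p + 1) * Y ^ 1).trace
        + (X ^ (2 * p) * Y ^ 2).trace + (X ^ 2 * Y ^ (2 * p)).trace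
        - 2 * (X ^ 1 * Y ^ (2 * p + 1)).trace + (X ^ 0 * Y ^ (2 * p + 2)).trace := by
    have a1 : (X * Y * X ^ (2 * p)).trace = (X ^ (2 * p + 1) * Y).trace := by
      rw [Matrix.trace_mul_comm, ← mul_assoc, pow_succ]
    have a2 : (Y * X * X ^ (2 * p)).trace = (X ^ (2 * p + 1) * Y).trace := by
      rw [mul_assoc, Matrix.trace_mul_comm, pow_succ']
    have a3 : (Y * Y * X ^ (2 * p)).trace = (X ^ (2 * p) * Y ^ 2).trace := by
      rw [Matrix.trace_mul_comm, sq]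
    have a4 : (Y * X * Y ^ (2 * p)).trace = (X * Y ^ (2 * p + 1)).trace := by
      rw [mul_assoc, Matrix.trace_mul_comm, mul_assoc, pow_succ]
    have a5 : (X * Y * Y ^ (2 * p)).trace = (X * Y ^ (2 * p + 1)).trace := by
      rw [mul_assoc, pow_succ']
    have a6 : X * X * X ^ (2 * p) = X ^ (2 * p + 2) := by rw [mul_assoc, ← pow_succ', ← pow_succ']
    have a7 : Y * Y * Y ^ (2 * p) = Y ^ (2 * p + 2) := by rw [mul_assoc, ← pow_succ', ← pow_succ']
    simp only [sub_mul, mul_sub, mul_add, Matrix.trace_sub, Matrix.trace_add, a1, a2, a3, a4, a5,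
      a6, a7, pow_zero, mul_one, one_mul, pow_one, sq X]
    ring
  have two : ∀ z : 𝕜, RCLike.re (2 * z) = 2 * RCLike.re z := fun z => by
    rw [two_mul, map_add, two_mul]
  rw [e1, e2]
  simp only [map_sub, map_add, two, h]
  simp only [← Finset.sum_add_distrib, ← Finset.sum_sub_distrib, Finset.mul_sum]
  refine Finset.sum_le_sum fun a _ => Finset.sum_le_sum fun b _ => ?_
  have := mul_le_mul_of_nonneg_left (sub_mul_pow_sub_pow_le (x a) (y b) p) (hc a b)
  refine le_trans (le_of_eq ?_) (this.trans (le_of_eq ?_)) <;> ring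

lemma mul_re_trace_pow_odd_le {X : Matrix κ κ 𝕜} (hX : X.IsHermitian) (a : ℝ) (p : ℕ) :
    a * RCLike.re (X ^ (2 * p + 1)).trace ≤
      RCLike.re (X ^ (2 * p + 2)).trace + a ^ 2 / 4 * RCLike.re (X ^ (2 * p)).trace := by
  obtain ⟨x, y, c, hc, h⟩ := exists_trace_pow_mul_pow hX hX
  have h' : ∀ j, RCLike.re (X ^ j).trace = ∑ a, ∑ b, c a b * x a ^ j := fun j => by
    simpa using h j 0
  simp only [h', Finset.mul_sum, ← Finset.sum_add_distrib]
  refine Finset.sum_le_sum fun i _ => Finset.sum_le_sum fun b _ => ?_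
  have h0 : 0 ≤ c i b * x i ^ (2 * p) := mul_nonneg (hc _ _) (by rw [pow_mul]; positivity)
  have := mul_nonneg h0 (sq_nonneg (x i - a / 2))
  refine le_of_sub_nonneg (this.trans (le_of_eq ?_))
  ring

lemma re_trace_pow_even_nonneg {X : Matrix κ κ 𝕜} (hX : X.IsHermitian) (p : ℕ) :
    0 ≤ RCLike.re (X ^ (2 * p)).trace := by
  obtain ⟨x, y, c, hc, h⟩ := exists_trace_pow_mul_pow hX hX
  have h' : RCLike.re (X ^ (2 * p)).trace = ∑ a, ∑ b, c a b * x a ^ (2 * p) := by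
    simpa using h (2 * p) 0
  rw [h']
  exact Finset.sum_nonneg fun i _ => Finset.sum_nonneg fun b _ =>
    mul_nonneg (hc _ _) (by rw [pow_mul]; positivity)

/-- A bound on an even trace moment bounds the eigenvalues, hence the quadratic form. -/
lemma abs_re_dotProduct_mulVec_le {X : Matrix κ κ 𝕜} (hX : X.IsHermitian) {s : ℝ} (hs : 0 ≤ s)
    {p : ℕ} (hp : p ≠ 0) (h : RCLike.re (X ^ (2 * p)).trace ≤ s ^ (2 * p)) (c : κ → 𝕜) :
    |RCLike.re (star c ⬝ᵥ X *ᵥ c)| ≤ s * ∑ a, ‖c a‖ ^ 2 := by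
  obtain ⟨U, x, hU, hU', hx⟩ := exists_pow_eq_mul_diagonal_mul hX
  have htr : ∀ k, RCLike.re (X ^ k).trace = ∑ a, x a ^ k := fun k => by
    rw [hx, Matrix.mul_assoc, Matrix.trace_mul_comm, Matrix.mul_assoc, hU, Matrix.mul_one,
      Matrix.trace_diagonal, map_sum]
    simp only [RCLike.ofReal_re]
  have hxs : ∀ a, |x a| ≤ s := fun a => by
    refine le_of_pow_le_pow_left₀ (n := 2 * p) (by omega) hs ?_
    rw [pow_mul |x a|, sq_abs, ← pow_mul]
    refine le_trans ?_ ((htr _).symm.le.trans h)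
    exact Finset.single_le_sum (f := fun a => x a ^ (2 * p))
      (fun b _ => by rw [pow_mul]; positivity) (Finset.mem_univ a)
  have hnorm : ∑ a, ‖(Uᴴ *ᵥ c) a‖ ^ 2 = ∑ a, ‖c a‖ ^ 2 := by
    have : star (Uᴴ *ᵥ c) ⬝ᵥ (Uᴴ *ᵥ c) = star c ⬝ᵥ c := by
      rw [Matrix.star_mulVec, Matrix.conjTranspose_conjTranspose, ← Matrix.dotProduct_mulVec,
        Matrix.mulVec_mulVec, hU', Matrix.one_mulVec]
    rw [star_dotProduct_self_eq_sum_norm_sq, star_dotProduct_self_eq_sum_norm_sq] at this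
    exact_mod_cast this
  have hquad : RCLike.re (star c ⬝ᵥ X *ᵥ c) = ∑ a, x a * ‖(Uᴴ *ᵥ c) a‖ ^ 2 := by
    have : star c ⬝ᵥ X *ᵥ c = star (Uᴴ *ᵥ c) ⬝ᵥ
        (Matrix.diagonal (fun a => ((x a : ℝ) : 𝕜)) *ᵥ (Uᴴ *ᵥ c)) := by
      conv_lhs => rw [← pow_one X, hx]
      rw [Matrix.star_mulVec, Matrix.conjTranspose_conjTranspose, ← Matrix.dotProduct_mulVec,
        Matrix.mulVec_mulVec, Matrix.mulVec_mulVec]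
      simp only [pow_one, Matrix.mul_assoc]
    rw [this, dotProduct, map_sum]
    refine Finset.sum_congr rfl fun a _ => ?_
    rw [Matrix.mulVec_diagonal, Pi.star_apply]
    have := RCLike.conj_mul ((Uᴴ *ᵥ c) a)
    rw [starRingEnd_apply] at this
    rw [mul_left_comm, this, ← RCLike.ofReal_pow, ← RCLike.ofReal_mul, RCLike.ofReal_re]
  rw [hquad, ← hnorm, Finset.mul_sum]
  refine (Finset.abs_sum_le_sum_abs _ _).trans (Finset.sum_le_sum fun a _ => ?_)
  rw [abs_mul, abs_of_nonneg (sq_nonneg ‖(Uᴴ *ᵥ c) a‖)]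
  exact mul_le_mul_of_nonneg_right (hxs a) (sq_nonneg _)

end Trace

/-! ### Trace moments of the sampled Gram matrix -/

section Moments

variable {𝕜 : Type*} [RCLike 𝕜] {ι κ : Type*} [Fintype ι]

/-- The matrix `∑ i, y i • v_i v_i*`, where `v_i*` is the `i`-th row of `V`. -/
noncomputable def weightedGram (V : Matrix ι κ 𝕜) (y : ι → ℝ) : Matrix κ κ 𝕜 :=
  ∑ i, (y i : 𝕜) • Matrix.vecMulVec (star (V i)) (V i)

/-- The probability that independent Bernoulli variables with parameters `w` take the values `b`. -/
noncomputable def bernoulliWeight (w : ι → ℝ) (b : ι → Bool) : ℝ :=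
  ∏ i, if b i then w i else 1 - w i

/-- The centred and normalised Bernoulli outcome `b i / w i - 1`. -/
noncomputable def deviation (w : ι → ℝ) (b : ι → Bool) (i : ι) : ℝ :=
  (if b i then 1 / w i else 0) - 1

lemma isHermitian_vecMulVec_star (v : κ → 𝕜) : (Matrix.vecMulVec (star v) v).IsHermitian := by
  rw [Matrix.IsHermitian, Matrix.conjTranspose_vecMulVec, star_star]

lemma isHermitian_weightedGram (V : Matrix ι κ 𝕜) (y : ι → ℝ) :
    (weightedGram V y).IsHermitian := by
  rw [Matrix.IsHermitian, weightedGram, Matrix.conjTranspose_sum]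
  refine Finset.sum_congr rfl fun i _ => ?_
  rw [Matrix.conjTranspose_smul, isHermitian_vecMulVec_star, RCLike.star_def, RCLike.conj_ofReal]

lemma weightedGram_one (V : Matrix ι κ 𝕜) : weightedGram V 1 = Vᴴ * V := by
  ext a b
  simp [weightedGram, Matrix.sum_apply, Matrix.mul_apply, Matrix.vecMulVec_apply]

lemma dotProduct_weightedGram_mulVec [Fintype κ] (V : Matrix ι κ 𝕜) (y : ι → ℝ) (c : κ → 𝕜) :
    RCLike.re (star c ⬝ᵥ weightedGram V y *ᵥ c) = ∑ i, y i * ‖(V *ᵥ c) i‖ ^ 2 := by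
  rw [weightedGram, Matrix.sum_mulVec, dotProduct_sum, map_sum]
  refine Finset.sum_congr rfl fun i _ => ?_
  rw [Matrix.smul_mulVec, dotProduct_smul, Matrix.vecMulVec_mulVec, dotProduct_smul]
  have h1 : star c ⬝ᵥ star (V i) = star ((V *ᵥ c) i) := by
    rw [Matrix.star_dotProduct_star]; rfl
  have h2 : V i ⬝ᵥ c = (V *ᵥ c) i := rfl
  rw [h1, h2, MulOpposite.smul_eq_mul_unop, MulOpposite.unop_op, RCLike.star_def, RCLike.conj_mul,
    smul_eq_mul, ← RCLike.ofReal_pow, ← RCLike.ofReal_mul, RCLike.ofReal_re]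

lemma bernoulliWeight_nonneg {w : ι → ℝ} (hw : ∀ i, 0 < w i ∧ w i ≤ 1) (b : ι → Bool) :
    0 ≤ bernoulliWeight w b :=
  Finset.prod_nonneg fun i _ => by
    split_ifs
    · exact (hw i).1.le
    · linarith [(hw i).2]

variable [DecidableEq ι]

lemma sum_bernoulliWeight (w : ι → ℝ) : ∑ b : ι → Bool, bernoulliWeight w b = 1 := by
  have := Finset.prod_univ_sum (fun _ : ι => (Finset.univ : Finset Bool))
    (fun i b => if b then w i else 1 - w i)
  rw [Fintype.piFinset_univ] at this
  simp only [bernoulliWeight, ← this]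
  simp

lemma sum_nonneg_of_update {F : (ι → Bool) → ℝ} (i : ι)
    (h : ∀ b, b i = true → 0 ≤ F b + F (Function.update b i false)) : 0 ≤ ∑ b, F b := by
  have hinv : Function.Involutive fun b : ι → Bool => Function.update b i (!b i) := fun b => by
    simp
  have h2 : 0 ≤ ∑ b, (F b + F (hinv.toPerm _ b)) := by
    refine Finset.sum_nonneg fun b _ => ?_
    simp only [Function.Involutive.coe_toPerm]
    rcases hb : b i with _ | _
    · have := h (Function.update b i true) (by simp)
      rw [Function.update_idem, ← hb, Function.update_eq_self, add_comm] at this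
      simpa [hb] using this
    · simpa [hb] using h b hb
  rw [Finset.sum_add_distrib, Equiv.sum_comp (hinv.toPerm _) F] at h2
  linarith

variable [Fintype κ] [DecidableEq κ]

lemma re_trace_vecMulVec_mul_pow_even_nonneg {X : Matrix κ κ 𝕜} (hX : X.IsHermitian) (v : κ → 𝕜)
    (p : ℕ) : 0 ≤ RCLike.re (Matrix.vecMulVec (star v) v * X ^ (2 * p)).trace := by
  have h : (Matrix.vecMulVec (star v) v * X ^ (2 * p)).trace =
      star (X ^ p *ᵥ star v) ⬝ᵥ (X ^ p *ᵥ star v) := by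
    rw [Matrix.trace_mul_comm, Matrix.mul_vecMulVec, Matrix.trace_vecMulVec, Matrix.star_mulVec,
      star_star, Matrix.IsHermitian.eq (hX.pow p), ← Matrix.dotProduct_mulVec, Matrix.mulVec_mulVec,
      ← pow_add, ← two_mul, dotProduct_comm]
  rw [h, star_dotProduct_self_eq_sum_norm_sq, RCLike.ofReal_re]
  positivity

/-- Resampling one coordinate changes the random matrix by a rank-one term `v v* / w`, to which the
mean value trace inequality applies. -/
lemma re_trace_resample_le (V : Matrix ι κ 𝕜) {w : ι → ℝ} (hw : ∀ i, 0 < w i ∧ w i ≤ 1)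
    (b : ι → Bool) (i : ι) (hb : b i = true) (p : ℕ) :
    RCLike.re (Matrix.vecMulVec (star (V i)) (V i) *
        weightedGram V (deviation w b) ^ (2 * p + 1)).trace -
      RCLike.re (Matrix.vecMulVec (star (V i)) (V i) *
        weightedGram V (deviation w (Function.update b i false)) ^ (2 * p + 1)).trace ≤
    (2 * p + 1) / 2 * ((∑ a, ‖V i a‖ ^ 2) / w i) *
      (RCLike.re (Matrix.vecMulVec (star (V i)) (V i) *
          weightedGram V (deviation w b) ^ (2 * p)).trace +
        RCLike.re (Matrix.vecMulVec (star (V i)) (V i) *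
          weightedGram V (deviation w (Function.update b i false)) ^ (2 * p)).trace) := by
  set A := Matrix.vecMulVec (star (V i)) (V i) with hA
  set X := weightedGram V (deviation w b) with hX
  set Y := weightedGram V (deviation w (Function.update b i false)) with hY
  have hwi := (hw i).1
  have hsub : X - Y = ((1 / w i : ℝ) : 𝕜) • A := by
    rw [hX, hY, weightedGram, weightedGram, ← Finset.sum_sub_distrib, Finset.sum_eq_single i]
    · rw [← sub_smul, ← RCLike.ofReal_sub]
      simp [deviation, hb, hA]
    · intro j _ hj
      simp [deviation, Function.update_of_ne hj]
    · simp
  have hAA : A * A = ((∑ a, ‖V i a‖ ^ 2 : ℝ) : 𝕜) • A := by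
    have : V i ⬝ᵥ star (V i) = ((∑ a, ‖V i a‖ ^ 2 : ℝ) : 𝕜) := by
      rw [dotProduct_comm, star_dotProduct_self_eq_sum_norm_sq]
    rw [hA, Matrix.vecMulVec_mul_vecMulVec, this, Matrix.vecMulVec_smul]
  have h := re_trace_sub_mul_pow_sub_pow_le (isHermitian_weightedGram V (deviation w b))
    (isHermitian_weightedGram V (deviation w (Function.update b i false))) p
  rw [← hX, ← hY, hsub, smul_mul_smul_comm, hAA, smul_smul] at h
  simp only [Matrix.smul_mul, Matrix.trace_smul, smul_eq_mul, ← RCLike.ofReal_mul,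
    RCLike.re_ofReal_mul, mul_sub, mul_add, Matrix.trace_sub, Matrix.trace_add, map_sub,
    map_add] at h
  have h' := mul_le_mul_of_nonneg_left h hwi.le
  refine (le_of_eq ?_).trans (h'.trans (le_of_eq ?_)) <;> field_simp

/-- The expectation of `tr X ^ k`, where `X = ∑ i, (b i / w i - 1) • v_i v_i*` is the deviation of
the sampled Gram matrix of `V` from its mean. -/
noncomputable def traceMoment (V : Matrix ι κ 𝕜) (w : ι → ℝ) (k : ℕ) : ℝ :=
  ∑ b, bernoulliWeight w b * RCLike.re (weightedGram V (deviation w b) ^ k).trace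

/-- Recursion for the even moments. The random variance proxy that results from resampling one
coordinate at a time is at most `K • (X + 3)`. -/
lemma traceMoment_even_le (V : Matrix ι κ 𝕜) (hV : Vᴴ * V = 1) {w : ι → ℝ}
    (hw : ∀ i, 0 < w i ∧ w i ≤ 1) {K : ℝ} (hK0 : 0 ≤ K)
    (hK : ∀ i, w i < 1 → (∑ a, ‖V i a‖ ^ 2) * max ((1 - w i) / w i) 1 ≤ K) (p : ℕ) :
    traceMoment V w (2 * p + 2) ≤
      (2 * p + 1) / 2 * K * (traceMoment V w (2 * p + 1) + 3 * traceMoment V w (2 * p)) := by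
  set X := fun b => weightedGram V (deviation w b) with hX
  set A := fun i => Matrix.vecMulVec (star (V i)) (V i) with hA
  have hsum : ∀ (b : ι → Bool) (y : ι → ℝ) (k : ℕ),
      RCLike.re (weightedGram V y * X b ^ k).trace =
        ∑ i, y i * RCLike.re (A i * X b ^ k).trace := fun b y k => by
    rw [weightedGram, Finset.sum_mul, Matrix.trace_sum, map_sum]
    refine Finset.sum_congr rfl fun i _ => ?_
    rw [Matrix.smul_mul, Matrix.trace_smul, smul_eq_mul, RCLike.re_ofReal_mul]
  have hsum1 : ∀ (b : ι → Bool) (k : ℕ), RCLike.re (X b ^ k).trace =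
      ∑ i, RCLike.re (A i * X b ^ k).trace := fun b k => by
    have := hsum b 1 k
    rw [weightedGram_one, hV, one_mul] at this
    simpa using this
  have hsumX : ∀ (b : ι → Bool) (k : ℕ), RCLike.re (X b ^ (k + 1)).trace =
      ∑ i, deviation w b i * RCLike.re (A i * X b ^ k).trace := fun b k => by
    rw [pow_succ', ← hsum]
  have hcoord : ∀ i, 0 ≤ ∑ b, bernoulliWeight w b *
      ((2 * p + 1) / 2 * K * ((deviation w b i + 3) * RCLike.re (A i * X b ^ (2 * p)).trace) -
        deviation w b i * RCLike.re (A i * X b ^ (2 * p + 1)).trace) := by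
    intro i
    refine sum_nonneg_of_update i fun b hb => ?_
    have key := re_trace_resample_le V hw b i hb p
    have g1 := re_trace_vecMulVec_mul_pow_even_nonneg
      (isHermitian_weightedGram V (deviation w b)) (V i) p
    have g0 := re_trace_vecMulVec_mul_pow_even_nonneg
      (isHermitian_weightedGram V (deviation w (Function.update b i false))) (V i) p
    simp only [hX, hA]
    have hR : ∀ b' : ι → Bool, bernoulliWeight w b' =
        (if b' i then w i else 1 - w i) *
          ∏ j ∈ Finset.univ.erase i, if b' j then w j else 1 - w j := fun b' =>
      (Finset.mul_prod_erase _ _ (Finset.mem_univ i)).symm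
    have hRR : (∏ j ∈ Finset.univ.erase i,
        if (Function.update b i false) j then w j else 1 - w j) =
        ∏ j ∈ Finset.univ.erase i, if b j then w j else 1 - w j :=
      Finset.prod_congr rfl fun j hj => by
        rw [Function.update_of_ne (Finset.ne_of_mem_erase hj)]
    have hR0 : 0 ≤ ∏ j ∈ Finset.univ.erase i, if b j then w j else 1 - w j :=
      Finset.prod_nonneg fun j _ => by
        split_ifs
        · exact (hw j).1.le
        · linarith [(hw j).2]
    have d1 : deviation w b i = 1 / w i - 1 := by simp [deviation, hb]
    have d0 : deviation w (Function.update b i false) i = -1 := by simp [deviation]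
    rw [hR, hR (Function.update b i false), hRR, d1, d0, hb, Function.update_self]
    simp only [if_true, Bool.false_eq_true, if_false]
    generalize (∏ j ∈ Finset.univ.erase i, if b j then w j else 1 - w j) = R at hR0 ⊢
    generalize RCLike.re (Matrix.vecMulVec (star (V i)) (V i) *
        weightedGram V (deviation w b) ^ (2 * p + 1)).trace = h1 at *
    generalize RCLike.re (Matrix.vecMulVec (star (V i)) (V i) *
        weightedGram V (deviation w (Function.update b i false)) ^ (2 * p + 1)).trace = h0 at *
    generalize RCLike.re (Matrix.vecMulVec (star (V i)) (V i) *
        weightedGram V (deviation w b) ^ (2 * p)).trace = s1 at *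
    generalize RCLike.re (Matrix.vecMulVec (star (V i)) (V i) *
        weightedGram V (deviation w (Function.update b i false)) ^ (2 * p)).trace = s0 at *
    have hwi := hw i
    have hr0 : 0 ≤ ∑ a, ‖V i a‖ ^ 2 := Finset.sum_nonneg fun _ _ => sq_nonneg _
    have hKi := hK i
    generalize (∑ a, ‖V i a‖ ^ 2) = r at *
    generalize hv : w i = v at *
    obtain ⟨hv0, hv1⟩ := hwi
    have hmain : (1 - v) * (h1 - h0) ≤
        (2 * p + 1) / 2 * K * ((1 + 2 * v) * s1 + (1 - v) * 2 * s0) := by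
      -- At `v = 1` the variable is constant and the coherence bound is not available.
      rcases hv1.lt_or_eq with hlt | rfl
      · have hKv := hKi hlt
        have k1 : r * ((1 - v) / v) ≤ K :=
          (mul_le_mul_of_nonneg_left (le_max_left _ _) hr0).trans hKv
        have k2 : r * 1 ≤ K := (mul_le_mul_of_nonneg_left (le_max_right _ _) hr0).trans hKv
        have e1 : (1 - v) * (r / v) = r * ((1 - v) / v) := by ring
        have e2 : r / v = r * ((1 - v) / v) + r := by field_simp; ring
        have c1 : (1 - v) * (r / v) ≤ K * (1 + 2 * v) := by
          rw [e1]; nlinarith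
        have c2 : (1 - v) * (r / v) ≤ K * ((1 - v) * 2) := by
          have : r / v ≤ 2 * K := by rw [e2]; linarith
          nlinarith
        have q0 : (0 : ℝ) ≤ (2 * p + 1) / 2 := by positivity
        calc (1 - v) * (h1 - h0)
            ≤ (1 - v) * ((2 * p + 1) / 2 * (r / v) * (s1 + s0)) :=
              mul_le_mul_of_nonneg_left key (by linarith)
          _ = (2 * p + 1) / 2 * ((1 - v) * (r / v) * s1 + (1 - v) * (r / v) * s0) := by ring
          _ ≤ (2 * p + 1) / 2 * (K * (1 + 2 * v) * s1 + K * ((1 - v) * 2) * s0) :=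
              mul_le_mul_of_nonneg_left (add_le_add (mul_le_mul_of_nonneg_right c1 g1)
                (mul_le_mul_of_nonneg_right c2 g0)) q0
          _ = _ := by ring
      · rw [sub_self, zero_mul]
        have : 0 ≤ (1 + 2 * (1 : ℝ)) * s1 + 0 * 2 * s0 := by linarith
        positivity
    have hfin : v * R * ((2 * p + 1) / 2 * K * ((1 / v - 1 + 3) * s1) - (1 / v - 1) * h1) +
        (1 - v) * R * ((2 * p + 1) / 2 * K * ((-1 + 3) * s0) - -1 * h0) =
        R * ((2 * p + 1) / 2 * K * ((1 + 2 * v) * s1 + (1 - v) * 2 * s0) -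
          (1 - v) * (h1 - h0)) := by
      field_simp
      ring
    rw [hfin]
    exact mul_nonneg hR0 (sub_nonneg.2 hmain)
  have htot := Finset.sum_nonneg fun i (_ : i ∈ Finset.univ) => hcoord i
  rw [Finset.sum_comm] at htot
  refine le_of_sub_nonneg (htot.trans (le_of_eq ?_))
  simp only [traceMoment, Finset.mul_sum, ← Finset.sum_add_distrib, ← Finset.sum_sub_distrib]
  refine Finset.sum_congr rfl fun b _ => ?_
  change _ = (2 * p + 1) / 2 * K * (bernoulliWeight w b * RCLike.re (X b ^ (2 * p + 1)).trace +
    3 * (bernoulliWeight w b * RCLike.re (X b ^ (2 * p)).trace)) -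
    bernoulliWeight w b * RCLike.re (X b ^ (2 * p + 1 + 1)).trace
  rw [hsumX b (2 * p + 1), hsumX b (2 * p), hsum1 b (2 * p)]
  simp only [Finset.mul_sum, ← Finset.sum_add_distrib, ← Finset.sum_sub_distrib]
  exact Finset.sum_congr rfl fun i _ => by ring

lemma traceMoment_even_le_mul (V : Matrix ι κ 𝕜) (hV : Vᴴ * V = 1) {w : ι → ℝ}
    (hw : ∀ i, 0 < w i ∧ w i ≤ 1) {K : ℝ} (hK0 : 0 ≤ K)
    (hK : ∀ i, w i < 1 → (∑ a, ‖V i a‖ ^ 2) * max ((1 - w i) / w i) 1 ≤ K) (p : ℕ)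
    (hp : (2 * p + 1) * K ≤ 1) :
    traceMoment V w (2 * p + 2) ≤ 4 * ((2 * p + 1) * K) * traceMoment V w (2 * p) := by
  have h1 := traceMoment_even_le V hV hw hK0 hK p
  -- `a * x ≤ x ^ 2 + a ^ 2 / 4` with `a = (2 * p + 1) * K` absorbs the odd moment.
  have h2 : (2 * p + 1) * K * traceMoment V w (2 * p + 1) ≤ traceMoment V w (2 * p + 2) +
      ((2 * p + 1) * K) ^ 2 / 4 * traceMoment V w (2 * p) := by
    simp only [traceMoment, Finset.mul_sum, ← Finset.sum_add_distrib]
    refine Finset.sum_le_sum fun b _ => ?_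
    have := mul_le_mul_of_nonneg_left
      (mul_re_trace_pow_odd_le (isHermitian_weightedGram V (deviation w b)) ((2 * p + 1) * K) p)
      (bernoulliWeight_nonneg hw b)
    refine (le_of_eq ?_).trans (this.trans (le_of_eq ?_)) <;> ring
  have h3 : 0 ≤ traceMoment V w (2 * p) := Finset.sum_nonneg fun b _ =>
    mul_nonneg (bernoulliWeight_nonneg hw b)
      (re_trace_pow_even_nonneg (isHermitian_weightedGram V (deviation w b)) p)
  have ha : 0 ≤ (2 * p + 1) * K := by positivity
  have h4 : ((2 * p + 1) * K) ^ 2 ≤ (2 * p + 1) * K := by nlinarith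
  nlinarith [mul_le_mul_of_nonneg_right h4 h3]

lemma traceMoment_even_le_pow (V : Matrix ι κ 𝕜) (hV : Vᴴ * V = 1) {w : ι → ℝ}
    (hw : ∀ i, 0 < w i ∧ w i ≤ 1) {K : ℝ} (hK0 : 0 ≤ K)
    (hK : ∀ i, w i < 1 → (∑ a, ‖V i a‖ ^ 2) * max ((1 - w i) / w i) 1 ≤ K) (p : ℕ)
    (hp : 2 * p * K ≤ 1) :
    traceMoment V w (2 * p) ≤ (8 * p * K) ^ p * Fintype.card κ := by
  have h : ∀ j ≤ p, traceMoment V w (2 * j) ≤ (8 * p * K) ^ j * Fintype.card κ := by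
    intro j
    induction j with
    | zero =>
      intro _
      simp [traceMoment, ← Finset.sum_mul, sum_bernoulliWeight, Matrix.trace_one]
    | succ j ih =>
      intro hj
      have hjp : (2 * (j : ℝ) + 1) ≤ 2 * p := by
        have : ((j + 1 : ℕ) : ℝ) ≤ p := by exact_mod_cast hj
        push_cast at this
        linarith
      have hjK := mul_le_mul_of_nonneg_right hjp hK0
      have h0 := ih (by omega)
      have h3 : 0 ≤ (8 * (p : ℝ) * K) ^ j * Fintype.card κ := by positivity
      calc traceMoment V w (2 * (j + 1))
          ≤ 4 * ((2 * j + 1) * K) * traceMoment V w (2 * j) :=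
            traceMoment_even_le_mul V hV hw hK0 hK j (hjK.trans hp)
        _ ≤ 4 * ((2 * j + 1) * K) * ((8 * p * K) ^ j * Fintype.card κ) :=
            mul_le_mul_of_nonneg_left h0 (by positivity)
        _ ≤ (8 * p * K) * ((8 * p * K) ^ j * Fintype.card κ) :=
            mul_le_mul_of_nonneg_right (by linarith) h3
        _ = _ := by ring
  exact h p le_rfl

open Classical in
/-- Markov's inequality for `tr X ^ (2 * p)`: the quadratic form of the sampled Gram matrix deviates
by more than one half with probability at most `(32 * p * K) ^ p` times the dimension. -/
lemma sum_bernoulliWeight_deviation_le (V : Matrix ι κ 𝕜) (hV : Vᴴ * V = 1) {w : ι → ℝ}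
    (hw : ∀ i, 0 < w i ∧ w i ≤ 1) {K : ℝ} (hK0 : 0 ≤ K)
    (hK : ∀ i, w i < 1 → (∑ a, ‖V i a‖ ^ 2) * max ((1 - w i) / w i) 1 ≤ K) {p : ℕ}
    (hp0 : p ≠ 0) (hp : 2 * p * K ≤ 1) :
    ∑ b with ¬ ∀ c : κ → 𝕜, |∑ i, deviation w b i * ‖(V *ᵥ c) i‖ ^ 2| ≤ 1 / 2 * ∑ a, ‖c a‖ ^ 2,
      bernoulliWeight w b ≤ (32 * p * K) ^ p * Fintype.card κ := by
  have hm := traceMoment_even_le_pow V hV hw hK0 hK p hp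
  have h4 : (32 * (p : ℝ) * K) ^ p = 4 ^ p * (8 * p * K) ^ p := by rw [← mul_pow]; ring
  rw [h4, mul_assoc]
  refine le_trans ?_ (mul_le_mul_of_nonneg_left hm (by positivity))
  rw [traceMoment, Finset.mul_sum]
  have hnn : ∀ b, 0 ≤ 4 ^ p * (bernoulliWeight w b *
      RCLike.re (weightedGram V (deviation w b) ^ (2 * p)).trace) := fun b =>
    mul_nonneg (by positivity) (mul_nonneg (bernoulliWeight_nonneg hw b)
      (re_trace_pow_even_nonneg (isHermitian_weightedGram V (deviation w b)) p))
  refine le_trans (Finset.sum_le_sum fun b hb => ?_)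
    (Finset.sum_le_sum_of_subset_of_nonneg (Finset.filter_subset _ _) fun b _ _ => hnn b)
  have hlarge : (1 / 2 : ℝ) ^ (2 * p) ≤
      RCLike.re (weightedGram V (deviation w b) ^ (2 * p)).trace := by
    by_contra! hlt
    refine (Finset.mem_filter.1 hb).2 fun c => ?_
    rw [← dotProduct_weightedGram_mulVec]
    exact abs_re_dotProduct_mulVec_le (isHermitian_weightedGram V (deviation w b))
      (by norm_num) hp0 hlt.le c
  have hone : (4 : ℝ) ^ p * (1 / 2) ^ (2 * p) = 1 := by
    rw [pow_mul, ← mul_pow]; norm_num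
  calc bernoulliWeight w b = bernoulliWeight w b * (4 ^ p * (1 / 2) ^ (2 * p)) := by
        rw [hone, mul_one]
    _ ≤ bernoulliWeight w b *
        (4 ^ p * RCLike.re (weightedGram V (deviation w b) ^ (2 * p)).trace) := by
        gcongr
        exact bernoulliWeight_nonneg hw b
    _ = _ := by ring

end Moments

/-! ### Bernoulli variables -/

section Probability

variable {n : ℕ} {Ω : Type*} [MeasurableSpace Ω] {P : Measure Ω} {ξ : Fin n → Ω → ℝ} {w : Fin n → ℝ}

lemma measureReal_bernoulli_cylinder (hw : ∀ i, 0 < w i ∧ w i ≤ 1)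
    (hlaw : ∀ i, HasLaw (ξ i) Ber((1 : ℝ), (0 : ℝ), ⟨w i, (hw i).1.le, (hw i).2⟩) P)
    (hindep : iIndepFun ξ P) (b : Fin n → Bool) :
    P.real {ω | ∀ i, ξ i ω = if b i then 1 else 0} = bernoulliWeight w b := by
  have hset : {ω | ∀ i, ξ i ω = if b i then 1 else 0} =
      ⋂ i ∈ (Finset.univ : Finset (Fin n)), ξ i ⁻¹' {if b i then (1 : ℝ) else 0} := by
    ext ω; simp
  rw [hset, measureReal_def, hindep.measure_inter_preimage_eq_mul Finset.univ
    (fun i _ => measurableSet_singleton _), ENNReal.toReal_prod, bernoulliWeight]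
  refine Finset.prod_congr rfl fun i _ => ?_
  have h := (hlaw i).measureReal_eq (p := fun x => x = if b i then (1 : ℝ) else 0)
    (measurableSet_singleton _)
  refine Eq.trans h ?_
  rcases b i with _ | _
  · exact bernoulliMeasure_real_apply_of_notMem_of_mem _ (measurableSet_singleton _)
      (by simp) (by simp)
  · exact bernoulliMeasure_real_apply_of_mem_of_notMem _ (measurableSet_singleton _)
      (by simp) (by simp)

/-- Reduction of a probability to a finite sum over outcomes. Only subadditivity is used, so that
`S` need not be measurable. -/
lemma one_sub_sum_bernoulliWeight_le [IsProbabilityMeasure P] (hw : ∀ i, 0 < w i ∧ w i ≤ 1)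
    (hlaw : ∀ i, HasLaw (ξ i) Ber((1 : ℝ), (0 : ℝ), ⟨w i, (hw i).1.le, (hw i).2⟩) P)
    (hindep : iIndepFun ξ P) {G : (Fin n → Bool) → Prop} [DecidablePred G] {S : Set Ω}
    (h : ∀ b, G b → ∀ ω, (∀ i, ξ i ω = if b i then 1 else 0) → ω ∈ S) :
    1 - ∑ b with ¬ G b, bernoulliWeight w b ≤ P.real S := by
  set E := fun b : Fin n → Bool => {ω | ∀ i, ξ i ω = if b i then 1 else 0} with hE
  set B := (Finset.univ : Finset (Fin n → Bool)).filter fun b => ¬ G b with hB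
  set N := {ω | ¬ ∀ i, ξ i ω = 1 ∨ ξ i ω = 0} with hN
  have hN0 : P.real N = 0 := by
    have hae : ∀ᵐ ω ∂P, ∀ i, ξ i ω = 1 ∨ ξ i ω = 0 := by
      refine ae_all_iff.2 fun i => ?_
      refine ((hlaw i).ae_iff (p := fun x => x = 1 ∨ x = 0) ?_).2 ?_
      · exact measurableSet_setOfPred.1 ((measurableSet_singleton 1).union
          (measurableSet_singleton 0))
      · exact bernoulliMeasure_apply_of_notMem_of_notMem _
          ((measurableSet_singleton (1 : ℝ)).union (measurableSet_singleton 0)).compl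
          (by simp) (by simp)
    rw [measureReal_def, show P N = 0 from hae, ENNReal.toReal_zero]
  have hcover : (Set.univ : Set Ω) ⊆ (S ∪ ⋃ b ∈ B, E b) ∪ N := by
    intro ω _
    by_cases hω : ∀ i, ξ i ω = 1 ∨ ξ i ω = 0
    · have hb : ∀ i, ξ i ω = if decide (ξ i ω = 1) then 1 else 0 := fun i => by
        rcases hω i with h | h <;> simp [h]
      refine Or.inl ?_
      by_cases hG : G fun i => decide (ξ i ω = 1)
      · exact Or.inl (h _ hG ω hb)
      · refine Or.inr (Set.mem_biUnion (x := fun i => decide (ξ i ω = 1)) ?_ hb)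
        simpa [hB] using hG
    · exact Or.inr hω
  have h1 : (1 : ℝ) ≤ P.real S + ∑ b ∈ B, P.real (E b) + P.real N := by
    rw [← probReal_univ (μ := P)]
    refine (measureReal_mono hcover).trans ((measureReal_union_le _ _).trans ?_)
    gcongr
    refine (measureReal_union_le _ _).trans ?_
    gcongr
    exact measureReal_biUnion_finset_le _ _
  have h2 : ∑ b ∈ B, P.real (E b) = ∑ b ∈ B, bernoulliWeight w b :=
    Finset.sum_congr rfl fun b _ => measureReal_bernoulli_cylinder hw hlaw hindep b
  linarith

end Probability

/-! ### Coherence, sampling and the choice of the moment -/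

section Sampling

variable {𝕜 : Type*} [RCLike 𝕜] {n : ℕ}

lemma mulVec_eq_inner_rowVec (F : Matrix (Fin n) (Fin n) 𝕜) (x : EuclideanSpace 𝕜 (Fin n))
    (j : Fin n) : (F *ᵥ x.ofLp) j = inner 𝕜 (rowVec F j) x := by
  simp [rowVec, PiLp.inner_apply, Matrix.mulVec, dotProduct, mul_comm]

lemma localCoherences_nonneg (F : Matrix (Fin n) (Fin n) 𝕜)
    (T : Set (EuclideanSpace 𝕜 (Fin n))) (j : Fin n) : 0 ≤ localCoherences F T j := by
  refine Real.sSup_nonneg ?_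
  rintro _ ⟨x, _, rfl⟩
  exact norm_nonneg _

lemma norm_mulVec_le_localCoherences (F : Matrix (Fin n) (Fin n) 𝕜)
    {T : Set (EuclideanSpace 𝕜 (Fin n))} {W : Submodule 𝕜 (EuclideanSpace 𝕜 (Fin n))}
    (hW : (W : Set (EuclideanSpace 𝕜 (Fin n))) ⊆ T) {x : EuclideanSpace 𝕜 (Fin n)} (hx : x ∈ W)
    (j : Fin n) : ‖(F *ᵥ x.ofLp) j‖ ≤ localCoherences F T j * ‖x‖ := by
  rcases eq_or_ne x 0 with rfl | hx0
  · simp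
  have hpos : 0 < ‖x‖ := norm_pos_iff.2 hx0
  have hbdd : BddAbove ((fun x => ‖inner 𝕜 (rowVec F j) x‖) '' (T ∩ Metric.closedBall 0 1)) := by
    refine ⟨‖rowVec F j‖, ?_⟩
    rintro _ ⟨y, hy, rfl⟩
    refine (norm_inner_le_norm _ _).trans ?_
    exact mul_le_of_le_one_right (norm_nonneg _) (mem_closedBall_zero_iff.1 hy.2)
  have hunit : ((‖x‖⁻¹ : ℝ) : 𝕜) • x ∈ T ∩ Metric.closedBall 0 1 :=
    ⟨hW (W.smul_mem _ hx), mem_closedBall_zero_iff.2 (by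
      rw [norm_smul, RCLike.norm_ofReal, abs_of_pos (inv_pos.2 hpos),
        inv_mul_cancel₀ hpos.ne'])⟩
  have hmem : ‖inner 𝕜 (rowVec F j) (((‖x‖⁻¹ : ℝ) : 𝕜) • x)‖ ≤ localCoherences F T j :=
    le_csSup hbdd (Set.mem_image_of_mem _ hunit)
  rw [inner_smul_right, norm_mul, RCLike.norm_ofReal, abs_of_pos (inv_pos.2 hpos),
    ← mulVec_eq_inner_rowVec, inv_mul_le_iff₀ hpos, mul_comm] at hmem
  exact hmem

/-- Coordinates on a subspace: in an orthonormal basis of `W`, the unitary `F` becomes a tall matrix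
`V` with orthonormal columns. -/
lemma exists_coordinates {F : Matrix (Fin n) (Fin n) 𝕜} (hF : F ∈ Matrix.unitaryGroup (Fin n) 𝕜)
    (W : Submodule 𝕜 (EuclideanSpace 𝕜 (Fin n))) :
    ∃ (V : Matrix (Fin n) (Fin (Module.finrank 𝕜 W)) 𝕜)
      (L : EuclideanSpace 𝕜 (Fin (Module.finrank 𝕜 W)) ≃ₗᵢ[𝕜] W),
      Vᴴ * V = 1 ∧ ∀ c, V *ᵥ c.ofLp = F *ᵥ (L c : EuclideanSpace 𝕜 (Fin n)).ofLp := by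
  set e := stdOrthonormalBasis 𝕜 W with he
  set E : Matrix (Fin n) (Fin (Module.finrank 𝕜 W)) 𝕜 :=
    Matrix.of fun i a => (e a : EuclideanSpace 𝕜 (Fin n)) i with hE
  have hEE : Eᴴ * E = 1 := by
    ext a b
    have h := orthonormal_iff_ite.1 e.orthonormal a b
    rw [Submodule.coe_inner, PiLp.inner_apply] at h
    rw [Matrix.mul_apply, Matrix.one_apply, ← h]
    refine Finset.sum_congr rfl fun i _ => ?_
    simp [hE, mul_comm]
  have hFF : Fᴴ * F = 1 := Matrix.mem_unitaryGroup_iff'.1 hF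
  refine ⟨F * E, e.repr.symm, ?_, fun c => ?_⟩
  · rw [Matrix.conjTranspose_mul, Matrix.mul_assoc, ← Matrix.mul_assoc Fᴴ, hFF, Matrix.one_mul, hEE]
  · rw [← Matrix.mulVec_mulVec]
    congr 1
    rw [← e.sum_repr_symm]
    ext i
    simp [hE, Matrix.mulVec, dotProduct, mul_comm]

/-- The squared norm of the projection of a row of `F` to `W` is at most its squared coherence. -/
lemma sum_norm_sq_row_le {F : Matrix (Fin n) (Fin n) 𝕜} {T : Set (EuclideanSpace 𝕜 (Fin n))}
    {W : Submodule 𝕜 (EuclideanSpace 𝕜 (Fin n))} (hW : (W : Set (EuclideanSpace 𝕜 (Fin n))) ⊆ T)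
    {κ : Type*} [Fintype κ] {V : Matrix (Fin n) κ 𝕜} (L : EuclideanSpace 𝕜 κ ≃ₗᵢ[𝕜] W)
    (hV : ∀ c, V *ᵥ c.ofLp = F *ᵥ (L c : EuclideanSpace 𝕜 (Fin n)).ofLp) (j : Fin n) :
    ∑ a, ‖V j a‖ ^ 2 ≤ localCoherences F T j ^ 2 := by
  -- The maximiser of `|f_j* x|` over the unit ball of `W` is the normalised projection of `f_j`.
  set c : EuclideanSpace 𝕜 κ := WithLp.toLp 2 (star (V j)) with hc
  have hr : (V *ᵥ c.ofLp) j = ((∑ a, ‖V j a‖ ^ 2 : ℝ) : 𝕜) := by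
    rw [← star_dotProduct_self_eq_sum_norm_sq, dotProduct_comm]
    rfl
  have hcn : ‖c‖ ^ 2 = ∑ a, ‖V j a‖ ^ 2 := by
    rw [EuclideanSpace.norm_sq_eq]
    simp [hc]
  have h := norm_mulVec_le_localCoherences F hW (L c).2 j
  have hn : ‖(L c : EuclideanSpace 𝕜 (Fin n))‖ = ‖c‖ := by
    rw [Submodule.norm_coe, L.norm_map]
  rw [← hV, hr, ← hcn, hn, RCLike.norm_ofReal, abs_of_nonneg (sq_nonneg _)] at h
  rw [← hcn]
  rcases (norm_nonneg c).eq_or_lt with h0 | h0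
  · rw [← h0, zero_pow two_ne_zero]
    exact sq_nonneg _
  · have : ‖c‖ ≤ localCoherences F T j := by
      rw [sq] at h
      exact le_of_mul_le_mul_right h h0
    gcongr

lemma sq_mul_max_le_bernoulliComplexity {m : ℕ} (hm : 1 ≤ m) {α w : Fin n → ℝ}
    (hα : ∀ j, 0 ≤ α j) {j : Fin n} (hw0 : 0 < w j) (hw : w j < 1) :
    α j ^ 2 * max ((1 - w j) / w j) 1 ≤ bernoulliComplexity m α w ^ 2 / m := by
  have hm0 : (0 : ℝ) < m := by exact_mod_cast hm
  have h : α j * √(m : ℝ) * max √((1 - w j) / w j) 1 ≤ bernoulliComplexity m α w := by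
    have := le_ciSup (Set.finite_range fun j : Fin n =>
      α j * √(m : ℝ) * max √((1 - w j) / w j) 1 * (if w j < 1 then 1 else 0)).bddAbove j
    simpa [bernoulliComplexity, hw] using this
  have hq : 0 ≤ (1 - w j) / w j := div_nonneg (by linarith) hw0.le
  have hmax : (max √((1 - w j) / w j) 1) ^ 2 = max ((1 - w j) / w j) 1 := by
    rcases le_total ((1 - w j) / w j) 1 with h1 | h1
    · rw [max_eq_right h1, max_eq_right (Real.sqrt_le_one.2 h1), one_pow]
    · rw [max_eq_left h1, max_eq_left (Real.one_le_sqrt.2 h1), Real.sq_sqrt hq]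
  rw [le_div_iff₀ hm0]
  have hα' := hα j
  calc _ = (α j * √(m : ℝ) * max √((1 - w j) / w j) 1) ^ 2 := by
        rw [mul_pow, mul_pow, hmax, Real.sq_sqrt hm0.le]; ring
    _ ≤ _ := by gcongr

lemma norm_sq_sampled {m : ℕ} (hm : 1 ≤ m) {w : Fin n → ℝ} (hw : ∀ i, 0 < w i ∧ w i ≤ 1)
    (F : Matrix (Fin n) (Fin n) 𝕜) (b : Fin n → Bool) {y : Fin n → ℝ}
    (hy : ∀ i, y i = if b i then 1 else 0) (u : Fin n → 𝕜) :
    ‖(WithLp.toLp 2 ((samplingMatrix 𝕜 m y * preconditioner 𝕜 m w * F) *ᵥ u) :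
      EuclideanSpace 𝕜 {i : Fin n // selectorMatrix 𝕜 m y i ≠ 0})‖ ^ 2 =
    ∑ i, (deviation w b i + 1) * ‖(F *ᵥ u) i‖ ^ 2 := by
  have hm0 : (0 : ℝ) < m := by exact_mod_cast hm
  have hent : ∀ i, ((selectorMatrix 𝕜 m y * preconditioner 𝕜 m w * F) *ᵥ u) i =
      ((√((n : ℝ) / m) * y i * √((m : ℝ) / (n * w i)) : ℝ) : 𝕜) * (F *ᵥ u) i := fun i => by
    rw [selectorMatrix, preconditioner, Matrix.diagonal_mul_diagonal, ← Matrix.mulVec_mulVec,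
      Matrix.mulVec_diagonal]
    push_cast
    ring
  have hsub : ∀ i : {i : Fin n // selectorMatrix 𝕜 m y i ≠ 0},
      ((samplingMatrix 𝕜 m y * preconditioner 𝕜 m w * F) *ᵥ u) i =
      ((selectorMatrix 𝕜 m y * preconditioner 𝕜 m w * F) *ᵥ u) i := fun i => rfl
  rw [EuclideanSpace.norm_sq_eq]
  simp only [hsub]
  have hzero : ∀ i, selectorMatrix 𝕜 m y i = 0 →
      ‖((selectorMatrix 𝕜 m y * preconditioner 𝕜 m w * F) *ᵥ u) i‖ ^ 2 = 0 := by
    intro i hi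
    have : ((√((n : ℝ) / (m : ℝ)) * y i : ℝ) : 𝕜) = 0 := by
      have := congrFun hi i
      simpa only [selectorMatrix, Matrix.diagonal_apply_eq, Pi.zero_apply] using this
    rw [hent, RCLike.ofReal_eq_zero.1 this]
    simp
  have hfull : ∑ i : {i : Fin n // selectorMatrix 𝕜 m y i ≠ 0},
      ‖((selectorMatrix 𝕜 m y * preconditioner 𝕜 m w * F) *ᵥ u) i‖ ^ 2 =
      ∑ i, ‖((selectorMatrix 𝕜 m y * preconditioner 𝕜 m w * F) *ᵥ u) i‖ ^ 2 := by
    classical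
    rw [← Finset.sum_filter_of_ne (p := fun i => selectorMatrix 𝕜 m y i ≠ 0)
      (fun i _ h h0 => h (hzero i h0))]
    refine (Finset.sum_subtype (p := fun i => selectorMatrix 𝕜 m y i ≠ 0) _ (fun i => ?_)
      fun i => ‖((selectorMatrix 𝕜 m y * preconditioner 𝕜 m w * F) *ᵥ u) i‖ ^ 2).symm
    rw [Finset.mem_filter, and_iff_right (Finset.mem_univ i)]
  rw [hfull]
  refine Finset.sum_congr rfl fun i _ => ?_
  have hn : (0 : ℝ) < n := by exact_mod_cast i.pos
  have hwi := (hw i).1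
  rw [hent, norm_mul, RCLike.norm_ofReal, mul_pow, sq_abs, mul_pow, mul_pow,
    Real.sq_sqrt (by positivity), Real.sq_sqrt (by positivity), hy i, deviation]
  split_ifs
  · field_simp; ring
  · simp

lemma abs_sub_one_le_of_abs_sq_sub_one_le {r : ℝ} (hr : 0 ≤ r) (h : |r ^ 2 - 1| ≤ 1 / 2) :
    |r - 1| ≤ 1 / 3 := by
  rw [abs_le] at h ⊢
  constructor <;> nlinarith

/-- Choice of the order of the moment: `p = ⌈L⌉` with `L = log ℓ + log M + t²`. The bound is trivial
for `t² ≤ log 2`, and otherwise `L ≥ log 2` keeps the rounding within a constant factor. -/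
lemma exists_moment_order {K : ℝ} (hK0 : 0 ≤ K) {M ℓ : ℕ} (hM : 1 ≤ M) (hℓ : 1 ≤ ℓ) {t : ℝ}
    (ht : Real.log 2 < t ^ 2) (hC : 240 * K * (Real.log ℓ + Real.log M + t ^ 2) ≤ 1) :
    ∃ p : ℕ, p ≠ 0 ∧ 2 * p * K ≤ 1 ∧
      M * ((32 * p * K) ^ p * ℓ) ≤ Real.exp (-t ^ 2) := by
  have hM0 : (0 : ℝ) < M := by exact_mod_cast hM
  have hℓ0 : (0 : ℝ) < ℓ := by exact_mod_cast hℓ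
  have hlM : 0 ≤ Real.log M := Real.log_natCast_nonneg M
  have hlℓ : 0 ≤ Real.log ℓ := Real.log_natCast_nonneg ℓ
  set L := Real.log ℓ + Real.log M + t ^ 2 with hL
  have h2 := Real.log_two_gt_d9
  have hLpos : 0 < L := by linarith
  have hpL : L ≤ ⌈L⌉₊ := Nat.le_ceil L
  have hpL' : (⌈L⌉₊ : ℝ) ≤ 5 / 2 * L := by
    have := (Nat.ceil_lt_add_one hLpos.le).le
    linarith
  have hpK : ⌈L⌉₊ * K ≤ 1 / 96 := by
    have := mul_le_mul_of_nonneg_right hpL' hK0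
    linarith
  refine ⟨⌈L⌉₊, (Nat.ceil_pos.2 hLpos).ne', by linarith, ?_⟩
  have he : 32 * (⌈L⌉₊ : ℝ) * K ≤ Real.exp (-1) := by
    have h3 : Real.exp 1 ≤ 3 := by linarith [Real.exp_one_lt_d9]
    have h4 : (1 / 3 : ℝ) ≤ Real.exp (-1) := by
      rw [Real.exp_neg, ← one_div]
      exact one_div_le_one_div_of_le (Real.exp_pos 1) h3
    linarith
  have hpow : (32 * (⌈L⌉₊ : ℝ) * K) ^ ⌈L⌉₊ ≤ Real.exp (-L) := by
    refine (pow_le_pow_left₀ (by positivity) he _).trans ?_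
    rw [← Real.exp_nat_mul]
    exact Real.exp_le_exp.2 (by linarith)
  calc M * ((32 * (⌈L⌉₊ : ℝ) * K) ^ ⌈L⌉₊ * ℓ) ≤ M * (Real.exp (-L) * ℓ) := by gcongr
    _ = Real.exp (Real.log M) * (Real.exp (-L) * Real.exp (Real.log ℓ)) := by
        rw [Real.exp_log hM0, Real.exp_log hℓ0]
    _ = Real.exp (-t ^ 2) := by
        rw [← Real.exp_add, ← Real.exp_add]
        congr 1
        rw [hL]; ring

end Sampling
end BernoulliCS

theorem mainTheorem3 :
    ∃ C : ℝ, 0 < C ∧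
      ∀ (𝕜 : Type*) [RCLike 𝕜] (n m M ℓ : ℕ) (_hm : 1 ≤ m) (_hM : 1 ≤ M) (_hℓ : 1 ≤ ℓ)
        (U : Fin M → Submodule 𝕜 (EuclideanSpace 𝕜 (Fin n)))
        (_hU : ∀ k, Module.finrank 𝕜 (U k) ≤ ℓ)
        (F : Matrix (Fin n) (Fin n) 𝕜) (_hF : F ∈ Matrix.unitaryGroup (Fin n) 𝕜)
        (w : Fin n → ℝ) (hw : ∀ i, 0 < w i ∧ w i ≤ 1) (_hsum : ∑ i, w i = (m : ℝ))
        (Ω : Type*) [MeasurableSpace Ω] (P : Measure Ω) [IsProbabilityMeasure P]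
        (ξ : Fin n → Ω → ℝ)
        (_hlaw : ∀ i, HasLaw (ξ i) Ber((1 : ℝ), (0 : ℝ), ⟨w i, (hw i).1.le, (hw i).2⟩) P)
        (_hindep : iIndepFun ξ P)
        (t : ℝ) (_ht : 0 < t),
        C * BernoulliCS.bernoulliComplexity m
              (BernoulliCS.localCoherences F (⋃ k, (U k : Set (EuclideanSpace 𝕜 (Fin n))))) w ^ 2
            * (Real.log ℓ + Real.log M + t ^ 2) ≤ (m : ℝ) →
        1 - 2 * Real.exp (-t ^ 2) ≤
          P.real {ω | BernoulliCS.RIP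
            (BernoulliCS.samplingMatrix 𝕜 m (fun i => ξ i ω) * BernoulliCS.preconditioner 𝕜 m w * F)
            (⋃ k, (U k : Set (EuclideanSpace 𝕜 (Fin n))))} := by
  classical
  open BernoulliCS in
  refine ⟨240, by norm_num, ?_⟩
  intro 𝕜 _ n m M ℓ hm hM hℓ U hU F hF w hw _ Ω _ P _ ξ hlaw hindep t _ hcond
  set T : Set (EuclideanSpace 𝕜 (Fin n)) := ⋃ k, (U k : Set (EuclideanSpace 𝕜 (Fin n))) with hT
  have hm0 : (0 : ℝ) < m := by exact_mod_cast hm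
  rcases le_or_gt (t ^ 2) (Real.log 2) with ht2 | ht2
  · have : (1 : ℝ) / 2 ≤ Real.exp (-t ^ 2) := by
      rw [one_div, ← Real.exp_log (show (0 : ℝ) < 2 by norm_num), ← Real.exp_neg]
      exact Real.exp_le_exp.2 (by linarith)
    exact le_trans (by linarith) measureReal_nonneg
  have hα := localCoherences_nonneg F T
  set K := bernoulliComplexity m (localCoherences F T) w ^ 2 / m with hKdef
  have hK0 : 0 ≤ K := by positivity
  have hKcond : 240 * K * (Real.log ℓ + Real.log M + t ^ 2) ≤ 1 := by
    have := div_le_one_of_le₀ hcond hm0.le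
    refine (le_of_eq ?_).trans this
    rw [hKdef]; ring
  obtain ⟨p, hp0, hpK, hbound⟩ := exists_moment_order hK0 hM hℓ ht2 hKcond
  choose V L hV hL using fun k => exists_coordinates hF (U k)
  have hUT : ∀ k, (U k : Set (EuclideanSpace 𝕜 (Fin n))) ⊆ T := fun k =>
    Set.subset_iUnion (fun k => (U k : Set (EuclideanSpace 𝕜 (Fin n)))) k
  set G : Fin M → (Fin n → Bool) → Prop := fun k b => ∀ c : Fin (Module.finrank 𝕜 (U k)) → 𝕜,
    |∑ i, deviation w b i * ‖(V k *ᵥ c) i‖ ^ 2| ≤ 1 / 2 * ∑ a, ‖c a‖ ^ 2 with hG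
  have hbad : ∀ k, ∑ b with ¬ G k b, bernoulliWeight w b ≤ (32 * p * K) ^ p * ℓ := fun k => by
    refine (sum_bernoulliWeight_deviation_le (V k) (hV k) hw hK0 (fun i hi => ?_) hp0 hpK).trans ?_
    · exact (mul_le_mul_of_nonneg_right (sum_norm_sq_row_le (hUT k) (L k) (hL k) i)
        (by positivity)).trans (sq_mul_max_le_bernoulliComplexity hm hα (hw i).1 hi)
    · rw [Fintype.card_fin]
      have : (Module.finrank 𝕜 (U k) : ℝ) ≤ ℓ := by exact_mod_cast hU k
      gcongr
  have hunion : ∑ b with ¬ ∀ k, G k b, bernoulliWeight w b ≤ Real.exp (-t ^ 2) := by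
    calc ∑ b with ¬ ∀ k, G k b, bernoulliWeight w b
        ≤ ∑ b, ∑ k, if ¬ G k b then bernoulliWeight w b else 0 := by
          rw [Finset.sum_filter]
          refine Finset.sum_le_sum fun b _ => ?_
          have hnn : ∀ k ∈ Finset.univ, 0 ≤ if ¬ G k b then bernoulliWeight w b else 0 :=
            fun k _ => by
              split_ifs
              · exact le_rfl
              · exact bernoulliWeight_nonneg hw b
          by_cases h : ∀ k, G k b
          · rw [if_neg (not_not.2 h)]
            exact Finset.sum_nonneg hnn
          · rw [if_pos h]
            obtain ⟨k, hk⟩ := not_forall.1 h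
            exact (if_pos (c := ¬ G k b) hk).symm.le.trans
              (Finset.single_le_sum hnn (Finset.mem_univ k))
      _ = ∑ k, ∑ b with ¬ G k b, bernoulliWeight w b := by
          rw [Finset.sum_comm]
          exact Finset.sum_congr rfl fun k _ => (Finset.sum_filter _ _).symm
      _ ≤ ∑ _k : Fin M, (32 * p * K) ^ p * ℓ := Finset.sum_le_sum fun k _ => hbad k
      _ = M * ((32 * p * K) ^ p * ℓ) := by simp
      _ ≤ _ := hbound
  refine le_trans ?_ (one_sub_sum_bernoulliWeight_le hw hlaw hindep (G := fun b => ∀ k, G k b) ?_)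
  · linarith [Real.exp_pos (-t ^ 2)]
  intro b hb ω hω u hu
  obtain ⟨k, hk⟩ := Set.mem_iUnion.1 hu.1
  have hu1 : ‖u‖ = 1 := mem_sphere_zero_iff_norm.1 hu.2
  set c := (L k).symm ⟨u, hk⟩ with hc
  have hLc : (L k c : EuclideanSpace 𝕜 (Fin n)) = u := by 
    rw [hc, LinearIsometryEquiv.apply_symm_apply]
  have hcn : ∑ a, ‖c a‖ ^ 2 = 1 := by
    rw [← EuclideanSpace.norm_sq_eq, ← (L k).norm_map, ← Submodule.norm_coe, hLc, hu1, one_pow]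
  have hiso : ∑ i, ‖(V k *ᵥ c.ofLp) i‖ ^ 2 = 1 := by
    have := dotProduct_weightedGram_mulVec (V k) 1 c.ofLp
    rw [weightedGram_one, hV, Matrix.one_mulVec, star_dotProduct_self_eq_sum_norm_sq,
      RCLike.ofReal_re, hcn] at this
    simpa using this.symm
  refine abs_sub_one_le_of_abs_sq_sub_one_le (norm_nonneg _) ?_
  rw [norm_sq_sampled hm hw F b hω, ← hLc, ← hL]
  simp only [add_mul, one_mul, Finset.sum_add_distrib, hiso, add_sub_cancel_right]
  have := hb k c.ofLp
  rwa [hcn, mul_one] at this
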